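/- Let $a$ and $b$ be integers with $a\geq 2$ and $b\geq 2$. Then there are positive constants $c_1(a,b)$ and $c_2(a,b)$, depending only on $a$ and $b$, such that \[ c_1(a,b)\,\frac{x}{(\ln x)^{1-1/b}}\leq \#\{1\leq n\leq x:\ \text{there are a prime } p \text{ and an integer } j\geq 0 \text{ such that } p+a^{j^{b}}=n\}\leq c_2(a,b)\,\frac{x}{(\ln x)^{1-1/b}} \] for any real number $x\geq 3$, where $n$ ranges over integers. -/

import Mathlib

/-! Put L = log x and R = L^(1/b), so the claimed order of magnitude is R · x/L. For the upper
bound, p + a^(j^b) ≤ x forces j ≤ 2R, and Chebyshev leaves O(x/L) choices of p.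

The lower bound is a second moment argument. For j up to R/a, let E_j be the primes up to x/2
shifted by a^(j^b). The union of the E_j lies in the set, and by Cauchy–Schwarz
(`sq_sum_card_le_card_biUnion_mul`) its size is at least (∑ |E_j|)² / ∑ |E_i ∩ E_j|. With J shifts
the numerator has order (J x/L)² and the diagonal of the denominator order J x/L. Off the diagonal,
|E_i ∩ E_j| counts pairs of primes with a fixed difference h. Since b ≥ 2, J ≤ 2R ≤ 2√L, so
O(x/L^(3/2)) for each pair suffices, with no averaging over h (`card_prime_pairs_le`).

That bound comes from Selberg's sieve, which gives O(M x/L²) with M = ∏_{p ∣ h} (1 + 1/p). The crude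
estimate M = O(√L) is elementary (`prod_primeFactors_one_add_inv_sq_le`). The Selberg sum is bounded
below by comparison with harmonic sums (`log_sq_le_selbergSum`), so Mertens' theorems are not
needed. -/

namespace BoundingSieve

/-! ### Selberg's Λ² sieve -/

open Finset ArithmeticFunction
open scoped ArithmeticFunction.Moebius

/-- The sum of the Selberg terms up to `z`, the reciprocal of the optimal main term. -/
noncomputable def selbergSum (s : BoundingSieve) (z : ℕ) : ℝ :=
  ∑ l ∈ s.prodPrimes.divisors with l ≤ z, s.selbergTerms l

/-- The weights minimising the quadratic form of the `Λ²` sieve of level `z ^ 2`. -/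
noncomputable def selbergWeight (s : BoundingSieve) (z d : ℕ) : ℝ :=
  (μ d : ℝ) / s.nu d *
    ((∑ l ∈ s.prodPrimes.divisors with d ∣ l ∧ l ≤ z, s.selbergTerms l) / s.selbergSum z)

theorem selbergSum_pos (s : BoundingSieve) {z : ℕ} (hz : 1 ≤ z) : 0 < s.selbergSum z := by
  refine sum_pos (fun l hl => ?_) ⟨1, ?_⟩
  · exact selbergTerms_pos (Nat.dvd_of_mem_divisors (mem_filter.1 hl).1)
  · simp [hz, prodPrimes_ne_zero]

theorem selbergWeight_one (s : BoundingSieve) {z : ℕ} (hz : 1 ≤ z) :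
    s.selbergWeight z 1 = 1 := by
  have h1 : s.nu 1 = 1 := s.nu_mult.map_one
  have := (s.selbergSum_pos hz).ne'
  simp only [selbergWeight, moebius_apply_one, h1, one_dvd, true_and]
  rw [← selbergSum, div_self this]
  simp

theorem selbergWeight_eq_zero (s : BoundingSieve) {z d : ℕ} (hd : z < d) :
    s.selbergWeight z d = 0 := by
  have : (s.prodPrimes.divisors.filter fun l => d ∣ l ∧ l ≤ z) = ∅ := by
    refine filter_eq_empty_iff.2 fun l hl h => ?_
    have := Nat.le_of_dvd (Nat.pos_of_mem_divisors hl) h.1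
    lia
  simp [selbergWeight, this]

/-- The sum over multiples of `d` is part of the full Selberg sum, so their ratio is at most 1. The
sharper classical bound by 1 is not needed. -/
theorem abs_selbergWeight_le (s : BoundingSieve) {z d : ℕ} (hz : 1 ≤ z)
    (hd : d ∣ s.prodPrimes) : |s.selbergWeight z d| ≤ (s.nu d)⁻¹ := by
  have hG := s.selbergSum_pos hz
  have hν := nu_pos_of_dvd_prodPrimes hd
  have hpos : ∀ l ∈ s.prodPrimes.divisors, 0 ≤ s.selbergTerms l := fun l hl =>
    (selbergTerms_pos (Nat.dvd_of_mem_divisors hl)).le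
  have h0 : 0 ≤ ∑ l ∈ s.prodPrimes.divisors with d ∣ l ∧ l ≤ z, s.selbergTerms l :=
    sum_nonneg fun l hl => hpos l (mem_filter.1 hl).1
  have h1 : ∑ l ∈ s.prodPrimes.divisors with d ∣ l ∧ l ≤ z, s.selbergTerms l ≤
      s.selbergSum z := by
    refine sum_le_sum_of_subset_of_nonneg ?_ fun l hl _ => hpos l (mem_filter.1 hl).1
    intro l hl
    simp only [mem_filter] at hl ⊢
    exact ⟨hl.1, hl.2.2⟩
  have hμ : |(μ d : ℝ)| ≤ 1 := by exact_mod_cast abs_moebius_le_one (n := d)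
  rw [selbergWeight, abs_mul, abs_div, abs_of_pos hν, abs_of_nonneg (div_nonneg h0 hG.le)]
  calc |(μ d : ℝ)| / s.nu d * _ ≤ 1 / s.nu d * 1 := by
        gcongr
        exact (div_le_one hG).2 h1
    _ = (s.nu d)⁻¹ := by simp

/-- With k = l·m and d = l·e, μ(d) = μ(l) μ(e), and the sum of μ(e) over e ∣ m detects m = 1. -/
theorem sum_moebius_between {k l : ℕ} (hk : Squarefree k) :
    ∑ d ∈ k.divisors with l ∣ d, (μ d : ℤ) = if k = l then μ l else 0 := by
  by_cases hlk : l ∣ k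
  · obtain ⟨m, rfl⟩ := hlk
    have hl0 : l ≠ 0 := by rintro rfl; simp at hk
    have hm0 : m ≠ 0 := by rintro rfl; simp at hk
    have : ((l * m).divisors.filter fun d => l ∣ d) = m.divisors.image (l * ·) := by
      ext d
      simp only [mem_filter, Nat.mem_divisors, mem_image]
      constructor
      · rintro ⟨⟨h1, h2⟩, e, rfl⟩
        exact ⟨e, ⟨Nat.dvd_of_mul_dvd_mul_left (Nat.pos_of_ne_zero hl0) h1, hm0⟩, rfl⟩
      · rintro ⟨e, ⟨h1, h2⟩, rfl⟩
        exact ⟨⟨Nat.mul_dvd_mul_left l h1, by positivity⟩, dvd_mul_right _ _⟩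
    rw [this, sum_image (fun x _ y _ h => Nat.eq_of_mul_eq_mul_left (Nat.pos_of_ne_zero hl0) h)]
    have hco : l.Coprime m := Nat.coprime_of_squarefree_mul hk
    have : ∀ e ∈ m.divisors, (μ (l * e) : ℤ) = μ l * μ e := fun e he =>
      isMultiplicative_moebius.map_mul_of_coprime
        (hco.coprime_dvd_right (Nat.dvd_of_mem_divisors he))
    rw [sum_congr rfl this, ← mul_sum, ← coe_mul_zeta_apply, moebius_mul_coe_zeta,
      one_apply]
    have : l * m = l ↔ m = 1 := by
      constructor
      · intro h; exact Nat.eq_of_mul_eq_mul_left (Nat.pos_of_ne_zero hl0) (by simpa using h)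
      · rintro rfl; simp
    simp [this]
  · rw [if_neg (by rintro rfl; exact hlk dvd_rfl)]
    refine sum_eq_zero fun d hd => ?_
    simp only [mem_filter, Nat.mem_divisors] at hd
    exact absurd (hd.2.trans hd.1.1) hlk

/-- These sums are the coordinates that diagonalise the quadratic form. Inserting the weights and
exchanging sums leaves ∑ μ(d) over l ∣ d ∣ k, which kills every k ≠ l. -/
theorem sum_nu_mul_selbergWeight (s : BoundingSieve) (z : ℕ) {l : ℕ} (hl : l ∣ s.prodPrimes) :
    (∑ d ∈ s.prodPrimes.divisors, if l ∣ d then s.nu d * s.selbergWeight z d else 0) =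
      if l ≤ z then (μ l : ℝ) * s.selbergTerms l / s.selbergSum z else 0 := by
  have hP := prodPrimes_ne_zero (s := s)
  have step : ∀ d ∈ s.prodPrimes.divisors,
      (if l ∣ d then s.nu d * s.selbergWeight z d else 0) =
      ∑ k ∈ s.prodPrimes.divisors, if l ∣ d ∧ d ∣ k ∧ k ≤ z then
        (μ d : ℝ) * (s.selbergTerms k / s.selbergSum z) else 0 := by
    intro d hd
    have hν := (nu_pos_of_dvd_prodPrimes (Nat.dvd_of_mem_divisors hd)).ne'
    by_cases h : l ∣ d
    · simp only [h, if_true, true_and]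
      rw [← sum_filter, ← mul_sum, ← sum_div, selbergWeight]
      field_simp
    · simp [h]
  rw [sum_congr rfl step, sum_comm]
  have step2 : ∀ k ∈ s.prodPrimes.divisors,
      (∑ d ∈ s.prodPrimes.divisors, if l ∣ d ∧ d ∣ k ∧ k ≤ z then
        (μ d : ℝ) * (s.selbergTerms k / s.selbergSum z) else 0) =
      if k = l then (if k ≤ z then (μ k : ℝ) * s.selbergTerms k / s.selbergSum z else 0)
        else 0 := by
    intro k hk
    have hkP := Nat.dvd_of_mem_divisors hk
    by_cases hkz : k ≤ z
    · simp only [hkz, and_true, if_true]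
      rw [← sum_filter, ← sum_mul]
      have : (s.prodPrimes.divisors.filter fun d => l ∣ d ∧ d ∣ k) =
          k.divisors.filter fun d => l ∣ d := by
        rw [← Nat.divisors_filter_dvd_of_dvd hP hkP, filter_filter]
        simp [and_comm]
      have h2 := sum_moebius_between (l := l) (squarefree_of_dvd_prodPrimes hkP)
      rw [this, ← Int.cast_sum, h2]
      split_ifs with h
      · subst h; ring
      · simp
    · simp [hkz]
  rw [sum_congr rfl step2, sum_ite_eq' _ l, if_pos (Nat.mem_divisors.2 ⟨hl, hP⟩)]

theorem mainSum_selbergWeight (s : BoundingSieve) {z : ℕ} (hz : 1 ≤ z) :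
    s.mainSum (lambdaSquared (s.selbergWeight z)) = (s.selbergSum z)⁻¹ := by
  have hG := (s.selbergSum_pos hz).ne'
  rw [mainSum_lambdaSquared_eq_sum_mul_sum_sq]
  have : ∀ l ∈ s.prodPrimes.divisors, (s.selbergTerms l)⁻¹ *
      (∑ d ∈ s.prodPrimes.divisors, if l ∣ d then s.nu d * s.selbergWeight z d else 0) ^ 2 =
      if l ≤ z then s.selbergTerms l / s.selbergSum z ^ 2 else 0 := by
    intro l hl
    have hlP := Nat.dvd_of_mem_divisors hl
    have hg := (selbergTerms_pos hlP).ne'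
    have hμ : (μ l : ℝ) ^ 2 = 1 := by
      exact_mod_cast moebius_sq_eq_one_of_squarefree (squarefree_of_dvd_prodPrimes hlP)
    rw [sum_nu_mul_selbergWeight s z hlP]
    split_ifs
    · rw [div_pow, mul_pow, hμ]
      field_simp
    · simp
  rw [sum_congr rfl this, ← sum_filter, ← sum_div, ← selbergSum]
  field_simp

/-- As lcm(d₁, d₂) ≤ d₁d₂, the error is at most (∑ |w d| d)². At most `z` terms are nonzero, each at
most z² because |w d| ≤ d. -/
theorem errSum_selbergWeight_le (s : BoundingSieve) {z : ℕ} (hz : 1 ≤ z)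
    (hν : ∀ d, d ∣ s.prodPrimes → (s.nu d)⁻¹ ≤ d)
    (hrem : ∀ d, d ∣ s.prodPrimes → |s.rem d| ≤ d) :
    s.errSum (lambdaSquared (s.selbergWeight z)) ≤ (z : ℝ) ^ 6 := by
  have hP := prodPrimes_ne_zero (s := s)
  set w := s.selbergWeight z with hw
  have hwd : ∀ d ∈ s.prodPrimes.divisors, |w d| * d ≤ if d ≤ z then (z : ℝ) ^ 2 else 0 := by
    intro d hd
    have hdP := Nat.dvd_of_mem_divisors hd
    split_ifs with h
    · have h1 := (s.abs_selbergWeight_le hz hdP).trans (hν d hdP)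
      have h2 : (d : ℝ) ≤ z := by exact_mod_cast h
      calc |w d| * d ≤ z * z := by
            gcongr
            exact h1.trans h2
        _ = _ := by ring
    · rw [hw, s.selbergWeight_eq_zero (not_le.1 h)]; simp
  have hsum : ∑ d ∈ s.prodPrimes.divisors, |w d| * d ≤ (z : ℝ) ^ 3 := by
    refine (sum_le_sum hwd).trans ?_
    rw [← sum_filter, sum_const, nsmul_eq_mul]
    have : (#{d ∈ s.prodPrimes.divisors | d ≤ z} : ℝ) ≤ z := by
      have : {d ∈ s.prodPrimes.divisors | d ≤ z} ⊆ Icc 1 z := by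
        intro d hd
        simp only [mem_filter] at hd
        exact mem_Icc.2 ⟨Nat.pos_of_mem_divisors hd.1, hd.2⟩
      exact_mod_cast (card_le_card this).trans (by simp)
    calc _ ≤ (z : ℝ) * z ^ 2 := by gcongr
      _ = _ := by ring
  calc s.errSum (lambdaSquared w)
      ≤ ∑ d ∈ s.prodPrimes.divisors, ∑ d1 ∈ s.prodPrimes.divisors,
          ∑ d2 ∈ s.prodPrimes.divisors,
            if d = Nat.lcm d1 d2 then (|w d1| * d1) * (|w d2| * d2) else 0 := by
        refine sum_le_sum fun d hd => ?_
        have hdP := Nat.dvd_of_mem_divisors hd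
        have hsub := Nat.divisors_subset_of_dvd hP hdP
        have hnn : ∀ d1 d2 : ℕ, 0 ≤
            if d = Nat.lcm d1 d2 then (|w d1| * d1) * (|w d2| * d2) else 0 := by
          intro d1 d2; split_ifs <;> positivity
        calc |lambdaSquared w d| * |s.rem d|
            ≤ (∑ d1 ∈ d.divisors, ∑ d2 ∈ d.divisors,
                |if d = Nat.lcm d1 d2 then w d1 * w d2 else 0|) * |s.rem d| := by
              gcongr
              refine (abs_sum_le_sum_abs _ _).trans (sum_le_sum fun _ _ => ?_)
              exact abs_sum_le_sum_abs _ _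
          _ = ∑ d1 ∈ d.divisors, ∑ d2 ∈ d.divisors,
                |if d = Nat.lcm d1 d2 then w d1 * w d2 else 0| * |s.rem d| := by
              simp_rw [sum_mul]
          _ ≤ ∑ d1 ∈ d.divisors, ∑ d2 ∈ d.divisors,
                if d = Nat.lcm d1 d2 then (|w d1| * d1) * (|w d2| * d2) else 0 := by
              refine sum_le_sum fun d1 h1 => sum_le_sum fun d2 h2 => ?_
              split_ifs with h
              · have hr : |s.rem d| ≤ d1 * d2 := by
                  refine (hrem d hdP).trans ?_
                  rw [h]
                  have := Nat.le_of_dvd (Nat.mul_pos (Nat.pos_of_mem_divisors h1)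
                    (Nat.pos_of_mem_divisors h2)) (Nat.lcm_dvd_mul d1 d2)
                  exact_mod_cast this
                rw [abs_mul]
                calc _ ≤ |w d1| * |w d2| * (d1 * d2) := by gcongr
                  _ = _ := by ring
              · simp
          _ ≤ ∑ d1 ∈ d.divisors, ∑ d2 ∈ s.prodPrimes.divisors,
                if d = Nat.lcm d1 d2 then (|w d1| * d1) * (|w d2| * d2) else 0 :=
              sum_le_sum fun d1 _ => sum_le_sum_of_subset_of_nonneg hsub fun _ _ _ => hnn _ _
          _ ≤ _ := sum_le_sum_of_subset_of_nonneg hsub fun _ _ _ =>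
              sum_nonneg fun _ _ => hnn _ _
    _ = ∑ d1 ∈ s.prodPrimes.divisors, ∑ d2 ∈ s.prodPrimes.divisors,
          (|w d1| * d1) * (|w d2| * d2) := by
        rw [sum_comm]
        refine sum_congr rfl fun d1 h1 => ?_
        rw [sum_comm]
        refine sum_congr rfl fun d2 h2 => ?_
        rw [sum_ite_eq' _ (Nat.lcm d1 d2), if_pos]
        exact Nat.mem_divisors.2 ⟨Nat.lcm_dvd (Nat.dvd_of_mem_divisors h1)
          (Nat.dvd_of_mem_divisors h2), hP⟩
    _ = (∑ d ∈ s.prodPrimes.divisors, |w d| * d) ^ 2 := by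
        rw [sq, sum_mul_sum]
    _ ≤ ((z : ℝ) ^ 3) ^ 2 := by
        gcongr
    _ = _ := by ring

/-- Selberg's upper bound sieve, with a crude error term. -/
theorem siftedSum_le_selberg (s : BoundingSieve) {z : ℕ} (hz : 1 ≤ z)
    (hν : ∀ d, d ∣ s.prodPrimes → (s.nu d)⁻¹ ≤ d)
    (hrem : ∀ d, d ∣ s.prodPrimes → |s.rem d| ≤ d) :
    s.siftedSum ≤ s.totalMass / s.selbergSum z + (z : ℝ) ^ 6 := by
  have h := s.siftedSum_le_mainSum_errSum_of_upperMoebius _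
    (upperMoebius_lambdaSquared _ (s.selbergWeight_one hz))
  rw [s.mainSum_selbergWeight hz] at h
  have := s.errSum_selbergWeight_le hz hν hrem
  rw [div_eq_mul_inv]
  linarith

end BoundingSieve

/-! ### Sieving n(n + h) by odd primes -/

open Finset ArithmeticFunction

/-- The product of the odd primes up to `z`. -/
def oddPrimorial (z : ℕ) : ℕ := ∏ p ∈ Icc 3 z with p.Prime, p

theorem prime_dvd_oddPrimorial_iff {p z : ℕ} (hp : p.Prime) :
    p ∣ oddPrimorial z ↔ 3 ≤ p ∧ p ≤ z := by
  rw [oddPrimorial, hp.prime.dvd_finsetProd_iff]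
  constructor
  · rintro ⟨q, hq, hpq⟩
    simp only [mem_filter, mem_Icc] at hq
    rw [(Nat.prime_dvd_prime_iff_eq hp hq.2).1 hpq]
    exact hq.1
  · rintro h
    exact ⟨p, by simp [hp, h], dvd_rfl⟩

theorem squarefree_oddPrimorial (z : ℕ) : Squarefree (oddPrimorial z) := by
  refine Finset.squarefree_prod_of_pairwise_isCoprime ?_ ?_
  · intro p hp q hq hpq
    simp only [coe_filter, mem_Icc, Set.mem_ofPred_eq] at hp hq
    exact Nat.coprime_iff_isRelPrime.1 ((Nat.coprime_primes hp.2 hq.2).2 hpq)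
  · intro p hp
    simp only [mem_filter] at hp
    exact hp.2.prime.squarefree

theorem dvd_oddPrimorial {l z : ℕ} (hl : Squarefree l) (hodd : l.Coprime 2) (hlz : l ≤ z) :
    l ∣ oddPrimorial z := by
  rw [← Nat.prod_primeFactors_of_squarefree hl]
  refine prod_dvd_prod_of_subset _ _ _ fun p hp => ?_
  have hpp := Nat.prime_of_mem_primeFactors hp
  have hpl := Nat.dvd_of_mem_primeFactors hp
  have h2 : p ≠ 2 := by
    rintro rfl
    have := Nat.dvd_gcd hpl dvd_rfl
    rw [hodd] at this
    simp at this
  have := hpp.two_le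
  have := Nat.le_of_dvd (Nat.pos_of_ne_zero hl.ne_zero) hpl
  simp only [mem_filter, mem_Icc]
  exact ⟨⟨by lia, by lia⟩, hpp⟩

/-- The density of the integers `n` with `d ∣ n * (n + h)`, for squarefree `d`. -/
noncomputable def pairDensity (h : ℕ) : ArithmeticFunction ℝ :=
  prodPrimeFactors fun p => if p ∣ h then 1 / (p : ℝ) else 2 / p

theorem pairDensity_prime (h : ℕ) {p : ℕ} (hp : p.Prime) :
    pairDensity h p = if p ∣ h then 1 / (p : ℝ) else 2 / p := by
  rw [pairDensity, prodPrimeFactors_apply hp.ne_zero, hp.primeFactors, prod_singleton]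

theorem isMultiplicative_pairDensity (h : ℕ) : (pairDensity h).IsMultiplicative :=
  IsMultiplicative.prodPrimeFactors _

theorem inv_pairDensity_le (h : ℕ) {d : ℕ} (hd : Squarefree d) : (pairDensity h d)⁻¹ ≤ d := by
  have hd0 : (0 : ℝ) < d := by exact_mod_cast Nat.pos_of_ne_zero hd.ne_zero
  refine inv_le_of_inv_le₀ hd0 ?_
  rw [pairDensity, prodPrimeFactors_apply hd.ne_zero]
  nth_rw 1 [← Nat.prod_primeFactors_of_squarefree hd]
  rw [Nat.cast_prod, ← prod_inv_distrib]
  refine prod_le_prod (fun _ _ => by positivity) fun p hp => ?_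
  split_ifs
  · simp
  · rw [inv_eq_one_div]; gcongr; norm_num

/-- Both sides are multiplicative by the Chinese remainder theorem. Modulo a prime the roots 0 and
-h coincide exactly when p ∣ h. -/
theorem card_roots_eq (h : ℕ) {d : ℕ} (hd : Squarefree d) :
    (Nat.card {x : ZMod d // x * (x + h) = 0} : ℝ) = d * pairDensity h d := by
  induction d using Nat.recOnPosPrimePosCoprime with
  | zero => simp at hd
  | one =>
    have : Subsingleton (ZMod 1) := inferInstanceAs (Subsingleton (Fin 1))
    have : Nat.card {x : ZMod 1 // x * (x + h) = 0} = 1 := by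
      rw [Nat.card_eq_one_iff_unique]
      exact ⟨inferInstance, ⟨⟨0, by simp⟩⟩⟩
    rw [this, (isMultiplicative_pairDensity h).map_one]
    simp
  | prime_pow p n hp hn =>
    have hn1 : n = 1 := by
      by_contra hne
      have := hd p (by
        rw [← sq]
        exact pow_dvd_pow p (by lia))
      exact hp.one_lt.ne' (Nat.isUnit_iff.1 this)
    subst hn1
    rw [pow_one, pairDensity_prime h hp]
    have hp0 : (p : ℝ) ≠ 0 := by exact_mod_cast hp.ne_zero
    have := Fact.mk hp
    split_ifs with hph
    · have h0 : (h : ZMod p) = 0 := (ZMod.natCast_eq_zero_iff h p).2 hph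
      have : Nat.card {x : ZMod p // x * (x + h) = 0} = 1 := by
        rw [Nat.card_eq_one_iff_unique]
        refine ⟨⟨fun x y => ?_⟩, ⟨⟨0, by simp⟩⟩⟩
        have hx := x.2
        have hy := y.2
        simp only [h0, add_zero, mul_self_eq_zero] at hx hy
        exact Subtype.ext (hx.trans hy.symm)
      rw [this]
      field_simp
      simp
    · have h0 : (h : ZMod p) ≠ 0 := fun H => hph ((ZMod.natCast_eq_zero_iff h p).1 H)
      have : Nat.card {x : ZMod p // x * (x + h) = 0} = 2 := by
        have e : {x : ZMod p | x * (x + h) = 0} = {0, -(h : ZMod p)} := by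
          ext x
          simp [add_eq_zero_iff_eq_neg]
        rw [← Set.coe_ofPred, Nat.card_coe_set_eq, e, Set.ncard_pair]
        exact fun H => h0 (neg_eq_zero.1 H.symm)
      rw [this]
      field_simp
      simp
  | coprime a b ha hb hab iha ihb =>
    have hsa := hd.squarefree_of_dvd (dvd_mul_right a b)
    have hsb := hd.squarefree_of_dvd (dvd_mul_left b a)
    rw [(isMultiplicative_pairDensity h).map_mul_of_coprime hab, Nat.cast_mul,
      mul_mul_mul_comm, ← iha hsa, ← ihb hsb, ← Nat.cast_mul, ← Nat.card_prod]
    congr 1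
    let f := ZMod.chineseRemainder hab
    refine Nat.card_congr (Equiv.trans (f.toEquiv.subtypeEquiv (q := fun y : ZMod a × ZMod b =>
      y.1 * (y.1 + h) = 0 ∧ y.2 * (y.2 + h) = 0) fun x => ?_)
      (Equiv.subtypeProdEquivProd (p := fun y : ZMod a => y * (y + h) = 0)
        (q := fun y : ZMod b => y * (y + h) = 0)))
    rw [← f.map_eq_zero_iff, map_mul, map_add, map_natCast, Prod.ext_iff]
    rfl

theorem abs_card_residue_sub_le (N d : ℕ) (hd : 0 < d) (v : ℕ) :
    |(#{n ∈ Ioc 0 N | n ≡ v [MOD d]} : ℝ) - N / d| ≤ 1 := by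
  have hd' : (0 : ℚ) < d := by exact_mod_cast hd
  have key := Nat.Ioc_filter_modEq_card 0 N hd v
  have hmono : ⌊((0 : ℕ) - v : ℚ) / d⌋ ≤ ⌊((N : ℕ) - v : ℚ) / d⌋ := by
    gcongr; simp
  rw [max_eq_left (by linarith)] at key
  have h1 := Int.floor_le (((0 : ℕ) - v : ℚ) / d)
  have h2 := Int.lt_floor_add_one (((0 : ℕ) - v : ℚ) / d)
  have h3 := Int.floor_le (((N : ℕ) - v : ℚ) / d)
  have h4 := Int.lt_floor_add_one (((N : ℕ) - v : ℚ) / d)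
  have e : ((N : ℚ) - v) / d = N / d + ((0 : ℕ) - v : ℚ) / d := by push_cast; ring
  have keyQ : (#{n ∈ Ioc 0 N | n ≡ v [MOD d]} : ℚ) =
      ⌊((N : ℕ) - v : ℚ) / d⌋ - ⌊((0 : ℕ) - v : ℚ) / d⌋ := by exact_mod_cast key
  have : |(#{n ∈ Ioc 0 N | n ≡ v [MOD d]} : ℚ) - N / d| ≤ 1 := by
    rw [abs_le, keyQ]
    constructor <;> linarith
  have := (Rat.cast_le (K := ℝ)).2 this
  push_cast at this
  exact this

/-- Each root modulo `d` contributes an error of at most 1, and there are at most `d` roots. -/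
theorem abs_card_dvd_sub_le (N h : ℕ) {d : ℕ} (hd : Squarefree d) :
    |(#{n ∈ Ioc 0 N | d ∣ n * (n + h)} : ℝ) - pairDensity h d * N| ≤ d := by
  have hd0 : 0 < d := Nat.pos_of_ne_zero hd.ne_zero
  have : NeZero d := ⟨hd0.ne'⟩
  have hdR : (d : ℝ) ≠ 0 := by exact_mod_cast hd0.ne'
  set R : Finset (ZMod d) := {x | x * (x + h) = 0} with hR
  have hcard : (#R : ℝ) = d * pairDensity h d := by
    rw [← card_roots_eq h hd, Nat.card_eq_fintype_card, Fintype.card_subtype]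
  have hmem : ∀ n : ℕ, d ∣ n * (n + h) ↔ (n : ZMod d) ∈ R := by
    intro n
    rw [← ZMod.natCast_eq_zero_iff]
    simp [hR]
  have hsplit : #{n ∈ Ioc 0 N | d ∣ n * (n + h)} =
      ∑ x ∈ R, #{n ∈ Ioc 0 N | n ≡ x.val [MOD d]} := by
    rw [card_eq_sum_card_fiberwise (f := fun n : ℕ => (n : ZMod d)) (t := R)]
    · refine sum_congr rfl fun x hx => ?_
      congr 1
      ext n
      simp only [mem_filter, and_assoc, and_congr_right_iff]
      intro _
      rw [← ZMod.natCast_eq_natCast_iff, ZMod.natCast_zmod_val, hmem]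
      exact ⟨fun H => H.2, fun H => ⟨H ▸ hx, H⟩⟩
    · intro n hn
      exact (hmem n).1 (mem_filter.1 hn).2
  have hR_le : (#R : ℝ) ≤ d := by
    have := card_le_univ R
    rw [ZMod.card] at this
    exact_mod_cast this
  have e : (#{n ∈ Ioc 0 N | d ∣ n * (n + h)} : ℝ) - pairDensity h d * N =
      ∑ x ∈ R, ((#{n ∈ Ioc 0 N | n ≡ x.val [MOD d]} : ℝ) - N / d) := by
    rw [hsplit, sum_sub_distrib, sum_const, nsmul_eq_mul, hcard]
    push_cast
    field_simp
  rw [e]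
  calc _ ≤ ∑ x ∈ R, |(#{n ∈ Ioc 0 N | n ≡ x.val [MOD d]} : ℝ) - N / d| :=
        abs_sum_le_sum_abs _ _
    _ ≤ ∑ x ∈ R, (1 : ℝ) := sum_le_sum fun x _ => abs_card_residue_sub_le N d hd0 _
    _ = #R := by simp
    _ ≤ d := hR_le

/-- The sieve of the values `n * (n + h)`, `1 ≤ n ≤ N`, by the odd primes up to `z`. -/
noncomputable def pairSieve (N h z : ℕ) : BoundingSieve where
  support := (Ioc 0 N).image fun n => n * (n + h)
  prodPrimes := oddPrimorial z
  prodPrimes_squarefree := squarefree_oddPrimorial z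
  weights := fun _ => 1
  weights_nonneg := fun _ => zero_le_one
  totalMass := N
  nu := pairDensity h
  nu_mult := isMultiplicative_pairDensity h
  nu_pos_of_prime := fun p hp _ => by
    have : (0 : ℝ) < p := by exact_mod_cast hp.pos
    rw [pairDensity_prime h hp]
    split_ifs <;> positivity
  -- For odd `h` the density at 2 would be 2/2 = 1, which is why 2 is left out of the sieving
  -- primes.
  nu_lt_one_of_prime := fun p hp hpz => by
    have h3 : (3 : ℝ) ≤ p := by exact_mod_cast ((prime_dvd_oddPrimorial_iff hp).1 hpz).1
    rw [pairDensity_prime h hp]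
    split_ifs <;> rw [div_lt_one (by linarith)] <;> linarith

/-- The support of the sieve is a set of values; injectivity turns sums over it into counts of `n`.
-/
theorem mul_add_injOn (h : ℕ) (s : Set ℕ) : Set.InjOn (fun n => n * (n + h)) s := by
  intro m _ n _ hmn
  by_contra hne
  simp only at hmn
  rcases Nat.lt_or_gt_of_ne hne with H | H
  · have := Nat.mul_lt_mul_of_lt_of_le H (Nat.add_le_add_right H.le h) (by lia)
    lia
  · have := Nat.mul_lt_mul_of_lt_of_le H (Nat.add_le_add_right H.le h) (by lia)
    lia

theorem card_prime_pairs_le_selberg (N h : ℕ) {z : ℕ} (hz : 1 ≤ z) :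
    (#{n ∈ Ioc 0 N | n.Prime ∧ (n + h).Prime} : ℝ) ≤
      z + N / (pairSieve N h z).selbergSum z + (z : ℝ) ^ 6 := by
  have key := (pairSieve N h z).siftedSum_le_selberg hz
    (fun d hd => inv_pairDensity_le h (BoundingSieve.squarefree_of_dvd_prodPrimes hd))
    (fun d hd => by
      have := abs_card_dvd_sub_le N h (BoundingSieve.squarefree_of_dvd_prodPrimes hd)
      simp only [BoundingSieve.rem, BoundingSieve.multSum, pairSieve]
      rwa [sum_image (mul_add_injOn h _), ← sum_filter, sum_const, nsmul_eq_mul, mul_one])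
  -- A prime n > z makes n and n + h both primes beyond z, hence unsifted; the n ≤ z are counted
  -- trivially.
  have hsub : {n ∈ Ioc 0 N | n.Prime ∧ (n + h).Prime} ⊆
      Icc 1 z ∪ {n ∈ Ioc 0 N | Nat.Coprime (oddPrimorial z) (n * (n + h))} := by
    intro n hn
    simp only [mem_filter, mem_union, mem_Icc, mem_Ioc] at hn ⊢
    by_cases hnz : n ≤ z
    · exact Or.inl ⟨hn.1.1, hnz⟩
    · right
      refine ⟨hn.1, ?_⟩
      have aux : ∀ q : ℕ, q.Prime → z < q → (oddPrimorial z).Coprime q := fun q hq hzq => by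
        rw [Nat.coprime_comm, hq.coprime_iff_not_dvd, prime_dvd_oddPrimorial_iff hq]
        lia
      exact (aux n hn.2.1 (by lia)).mul_right (aux _ hn.2.2 (by lia))
  have hsift : (pairSieve N h z).siftedSum =
      #{n ∈ Ioc 0 N | Nat.Coprime (oddPrimorial z) (n * (n + h))} := by
    change (∑ m ∈ (Ioc 0 N).image fun n => n * (n + h),
      if Nat.Coprime (oddPrimorial z) m then (1 : ℝ) else 0) = _
    rw [sum_image (mul_add_injOn h _), ← sum_filter, sum_const, nsmul_eq_mul, mul_one]
  have hc : (#{n ∈ Ioc 0 N | n.Prime ∧ (n + h).Prime} : ℝ) ≤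
      z + #{n ∈ Ioc 0 N | Nat.Coprime (oddPrimorial z) (n * (n + h))} := by
    have := (card_le_card hsub).trans (card_union_le _ _)
    rw [Nat.card_Icc] at this
    exact_mod_cast this
  rw [← hsift] at hc
  have : (pairSieve N h z).totalMass = N := rfl
  rw [this] at key
  linarith

/-! ### Lower bound for the Selberg sum through harmonic sums -/

/-- The sum of the reciprocals of the squarefree integers up to `y` having no divisor in `T`. -/
noncomputable def sievedHarmonic (T : Finset ℕ) (y : ℕ) : ℝ :=
  ∑ v ∈ Icc 1 y with Squarefree v ∧ ∀ p ∈ T, ¬ p ∣ v, 1 / (v : ℝ)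

theorem sievedHarmonic_nonneg (T : Finset ℕ) (y : ℕ) : 0 ≤ sievedHarmonic T y :=
  sum_nonneg fun _ _ => by positivity

/-- Allows comparison through a parametrisation that covers `t` without being injective. -/
theorem sum_le_sum_of_subset_image {α β : Type*} [DecidableEq β] {s : Finset α} {t : Finset β}
    {f : β → ℝ} (g : α → β) (hf : ∀ x, 0 ≤ f x) (h : t ⊆ s.image g) :
    ∑ x ∈ t, f x ≤ ∑ a ∈ s, f (g a) := by
  refine (sum_le_sum_of_subset_of_nonneg h fun x _ _ => hf x).trans ?_
  have := sum_fiberwise_of_maps_to (s := s) (t := s.image g) (g := g)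
    (fun a ha => mem_image_of_mem g ha) (fun a => f (g a))
  rw [← this]
  refine sum_le_sum fun x hx => ?_
  obtain ⟨a, ha, rfl⟩ := mem_image.1 hx
  exact single_le_sum (f := fun a => f (g a)) (fun a _ => hf _) (mem_filter.2 ⟨ha, rfl⟩)

theorem sum_inv_sq_le_two (y : ℕ) : ∑ m ∈ Icc 1 y, 1 / (m : ℝ) ^ 2 ≤ 2 := by
  -- The subtracted term lets the induction telescope.
  have h : ∀ n : ℕ, ∑ m ∈ Icc 1 (n + 1), 1 / (m : ℝ) ^ 2 ≤ 2 - 1 / ((n : ℝ) + 1) := by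
    intro n
    induction n with
    | zero => norm_num
    | succ n ih =>
      rw [sum_Icc_succ_top (by lia)]
      have : 1 / ((n + 1 + 1 : ℕ) : ℝ) ^ 2 ≤ 1 / ((n : ℝ) + 1) - 1 / ((n + 1 : ℕ) + 1 : ℝ) := by
        push_cast
        rw [div_sub_div _ _ (by positivity) (by positivity),
          div_le_div_iff₀ (by positivity) (by positivity)]
        nlinarith
      linarith
  rcases y with _ | n
  · norm_num
  · have := h n
    have h2 : (0 : ℝ) ≤ 1 / ((n : ℝ) + 1) := by positivity
    linarith

/-- Writing n = m²s with s squarefree bounds the harmonic sum by ∑ 1/m² ≤ 2 times its squarefree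
part. -/
theorem log_le_two_mul_sievedHarmonic (y : ℕ) : Real.log y ≤ 2 * sievedHarmonic ∅ y := by
  rcases Nat.eq_zero_or_pos y with rfl | hy
  · simpa using sievedHarmonic_nonneg ∅ 0
  have h1 : Real.log y ≤ ∑ n ∈ Icc 1 y, 1 / (n : ℝ) := by
    have := log_add_one_le_harmonic y
    rw [harmonic_eq_sum_Icc] at this
    push_cast at this
    have h2 : Real.log y ≤ Real.log ((y : ℝ) + 1) :=
      Real.log_le_log (by exact_mod_cast hy) (by linarith)
    simp only [one_div]
    linarith
  have h2 : ∑ n ∈ Icc 1 y, 1 / (n : ℝ) ≤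
      ∑ a ∈ Icc 1 y ×ˢ {v ∈ Icc 1 y | Squarefree v ∧ ∀ p ∈ (∅ : Finset ℕ), ¬ p ∣ v},
        1 / ((a.1 ^ 2 * a.2 : ℕ) : ℝ) := by
    refine sum_le_sum_of_subset_image (f := fun n : ℕ => 1 / (n : ℝ))
      (fun a : ℕ × ℕ => a.1 ^ 2 * a.2) (fun _ => by positivity) ?_
    intro n hn
    rw [mem_Icc] at hn
    obtain ⟨s, m, hsm, hs⟩ := Nat.sq_mul_squarefree n
    have hm0 : m ≠ 0 := by rintro rfl; simp at hsm; lia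
    have hs0 := Nat.pos_of_ne_zero hs.ne_zero
    have hm1 : m ≤ n := by
      rw [← hsm]
      calc m ≤ m ^ 2 := Nat.le_self_pow (by simp) m
        _ ≤ _ := Nat.le_mul_of_pos_right _ hs0
    have hs1 : s ≤ n := by
      rw [← hsm]
      exact Nat.le_mul_of_pos_left _ (by positivity)
    refine mem_image.2 ⟨(m, s), ?_, hsm⟩
    simp only [mem_product, mem_Icc, mem_filter]
    refine ⟨⟨by lia, by lia⟩, ⟨by lia, by lia⟩, hs, by simp⟩
  have h3 : ∑ a ∈ Icc 1 y ×ˢ {v ∈ Icc 1 y | Squarefree v ∧ ∀ p ∈ (∅ : Finset ℕ), ¬ p ∣ v},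
        1 / ((a.1 ^ 2 * a.2 : ℕ) : ℝ) =
      (∑ m ∈ Icc 1 y, 1 / (m : ℝ) ^ 2) * sievedHarmonic ∅ y := by
    rw [sievedHarmonic, sum_mul_sum, ← sum_product']
    refine sum_congr rfl fun a _ => ?_
    push_cast
    rw [one_div_mul_one_div]
  have := mul_le_mul_of_nonneg_right (sum_inv_sq_le_two y) (sievedHarmonic_nonneg ∅ y)
  linarith

/-- A squarefree multiple of `p` is p·w with p ∤ w, so the multiples contribute at most 1/p times
the sum free of `p`. -/
theorem sievedHarmonic_insert {T : Finset ℕ} {p : ℕ} (hp : p.Prime) (y : ℕ) :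
    sievedHarmonic T y ≤ (1 + 1 / (p : ℝ)) * sievedHarmonic (insert p T) y := by
  have hp0 : (0 : ℝ) < p := by exact_mod_cast hp.pos
  rw [sievedHarmonic, ← sum_filter_add_sum_filter_not _ (fun v => ¬ p ∣ v), add_mul, one_mul]
  gcongr
  · refine (sum_congr ?_ fun _ _ => rfl).le
    ext v
    simp only [mem_filter, mem_insert, forall_eq_or_imp]
    tauto
  · rw [sievedHarmonic, mul_sum]
    have : ∀ v : ℕ, 1 / (p : ℝ) * (1 / v) = 1 / ((p * v : ℕ) : ℝ) := fun v => by
      push_cast; rw [one_div_mul_one_div]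
    simp_rw [this]
    refine sum_le_sum_of_subset_image (f := fun n : ℕ => 1 / (n : ℝ)) (fun v => p * v)
      (fun _ => by positivity) ?_
    intro v hv
    simp only [mem_filter, mem_Icc, not_not] at hv
    obtain ⟨⟨⟨h1, h2⟩, hsq, hT⟩, w, rfl⟩ := hv
    refine mem_image.2 ⟨w, ?_, rfl⟩
    have hw : w ≠ 0 := by rintro rfl; simp at hsq
    have hwy : w ≤ p * w := Nat.le_mul_of_pos_left _ hp.pos
    simp only [mem_filter, mem_Icc, mem_insert, forall_eq_or_imp]
    refine ⟨⟨by lia, by lia⟩, hsq.squarefree_of_dvd (dvd_mul_left _ _), ?_, fun q hq hqw =>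
      hT q hq (hqw.mul_left p)⟩
    exact hp.coprime_iff_not_dvd.1 (Nat.coprime_of_squarefree_mul hsq)

theorem sievedHarmonic_empty_le {T : Finset ℕ} (hT : ∀ p ∈ T, p.Prime) (y : ℕ) :
    sievedHarmonic ∅ y ≤ (∏ p ∈ T, (1 + 1 / (p : ℝ))) * sievedHarmonic T y := by
  induction T using Finset.induction_on with
  | empty => simp
  | insert p T hpT ih =>
    have h1 := ih fun q hq => hT q (mem_insert_of_mem hq)
    have h2 := sievedHarmonic_insert (T := T) (hT p (mem_insert_self p T)) y
    rw [prod_insert hpT]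
    have h3 : 0 ≤ ∏ p ∈ T, (1 + 1 / (p : ℝ)) := prod_nonneg fun _ _ => by positivity
    calc _ ≤ _ := h1
      _ ≤ _ := mul_le_mul_of_nonneg_left h2 h3
      _ = _ := by ring

theorem log_le_mul_sievedHarmonic {T : Finset ℕ} (hT : ∀ p ∈ T, p.Prime) (y : ℕ) :
    Real.log y ≤ 2 * ((∏ p ∈ T, (1 + 1 / (p : ℝ))) * sievedHarmonic T y) := by
  have := log_le_two_mul_sievedHarmonic y
  have := sievedHarmonic_empty_le hT y
  linarith

/-- At a prime the density is 1/p, plus another 1/p when p ∤ h; expanding the product over p ∣ l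
gives a Dirichlet convolution. -/
theorem pairDensity_eq_sum (h : ℕ) {l : ℕ} (hl : Squarefree l) :
    pairDensity h l = ∑ a ∈ l.divisorsAntidiagonal with a.1.Coprime h,
      1 / ((a.1 : ℝ) * a.2) := by
  let f : ArithmeticFunction ℝ := ⟨fun n => (n : ℝ)⁻¹, by simp⟩
  let g : ArithmeticFunction ℝ := ⟨fun n => if n.Coprime h then (n : ℝ)⁻¹ else 0, by simp⟩
  have hf : f.IsMultiplicative := by
    refine ⟨by simp [f], fun {m n} _ => ?_⟩
    simp [f, mul_comm]
  have hg : g.IsMultiplicative := by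
    refine ⟨by simp [g], fun {m n} _ => ?_⟩
    simp only [g, coe_mk, Nat.coprime_mul_iff_left]
    split_ifs <;> simp_all [mul_comm]
  have key := IsMultiplicative.prodPrimeFactors_add_of_squarefree hg hf hl
  rw [ArithmeticFunction.mul_apply] at key
  rw [sum_filter]
  have e : ∀ a : ℕ × ℕ, (if a.1.Coprime h then 1 / ((a.1 : ℝ) * a.2) else 0) = g a.1 * f a.2 := by
    intro a
    simp only [f, g, coe_mk]
    split_ifs <;> simp [mul_comm]
  simp_rw [e]
  rw [← key, pairDensity, prodPrimeFactors_apply hl.ne_zero, prodPrimeFactors_apply hl.ne_zero]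
  refine prod_congr rfl fun p hp => ?_
  have hpp := Nat.prime_of_mem_primeFactors hp
  have hgf : (g + f) p = (if p.Coprime h then (p : ℝ)⁻¹ else 0) + (p : ℝ)⁻¹ := rfl
  simp only [hgf, hpp.coprime_iff_not_dvd]
  by_cases hph : p ∣ h
  · simp [hph]
  · simp only [hph, not_false_eq_true, if_true, if_false]
    ring

/-- A Selberg term is the density times factors 1/(1 - ν(p)) ≥ 1. -/
theorem sum_pairDensity_le_selbergSum (N h z : ℕ) :
    ∑ l ∈ (oddPrimorial z).divisors with l ≤ z, pairDensity h l ≤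
      (pairSieve N h z).selbergSum z := by
  refine sum_le_sum fun l hl => ?_
  have hl' : l ∣ (pairSieve N h z).prodPrimes := Nat.dvd_of_mem_divisors (mem_filter.1 hl).1
  rw [BoundingSieve.selbergTerms_apply]
  refine le_mul_of_one_le_right (BoundingSieve.nu_pos_of_dvd_prodPrimes hl').le ?_
  have : ∀ s : Finset ℕ, ∀ g : ℕ → ℝ, (∀ p ∈ s, 1 ≤ g p) → 1 ≤ ∏ p ∈ s, g p := fun s g hg => by
    calc (1 : ℝ) = ∏ _p ∈ s, 1 := by simp
      _ ≤ _ := prod_le_prod (fun _ _ => zero_le_one) hg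
  refine this _ _ fun p hp => ?_
  have hpp := Nat.prime_of_mem_primeFactors hp
  have hpP := (Nat.dvd_of_mem_primeFactors hp).trans hl'
  have h1 := (pairSieve N h z).nu_pos_of_prime p hpp hpP
  have h2 := (pairSieve N h z).nu_lt_one_of_prime p hpp hpP
  exact (one_le_inv₀ (by linarith)).2 (by linarith)

/-- For k, e from the two sums and c = gcd(k, e), write k = c·k', e = c·e'. Then e'k' ≤ y² is
squarefree and odd with e' coprime to `h`, so it occurs in the expansion of `pairDensity`; summing
1/c² costs the factor 2. -/
theorem sievedHarmonic_mul_le (h y : ℕ) (hh : h ≠ 0) :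
    sievedHarmonic {2} y * sievedHarmonic (insert 2 h.primeFactors) y ≤
      2 * ∑ l ∈ (oddPrimorial (y ^ 2)).divisors with l ≤ y ^ 2, pairDensity h l := by
  set Q : Finset (ℕ × ℕ) := {a ∈ Icc 1 y ×ˢ Icc 1 y |
    Squarefree (a.1 * a.2) ∧ (a.1 * a.2).Coprime 2 ∧ a.1.Coprime h} with hQ
  have h1 : sievedHarmonic {2} y * sievedHarmonic (insert 2 h.primeFactors) y ≤
      (∑ c ∈ Icc 1 y, 1 / (c : ℝ) ^ 2) * ∑ a ∈ Q, 1 / ((a.1 : ℝ) * a.2) := by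
    rw [sievedHarmonic, sievedHarmonic, sum_mul_sum, sum_mul_sum, ← sum_product',
      ← sum_product']
    let F : ℕ × ℕ → ℝ := fun b => 1 / ((b.1 : ℝ) * b.2)
    let g : ℕ × (ℕ × ℕ) → ℕ × ℕ := fun b => (b.1 * b.2.2, b.1 * b.2.1)
    have e2 : ∀ b : ℕ × (ℕ × ℕ), F (g b) = 1 / (b.1 : ℝ) ^ 2 * (1 / ((b.2.1 : ℝ) * b.2.2)) := by
      intro b
      simp only [F, g, one_div_mul_one_div, Nat.cast_mul]
      congr 1
      ring
    have e1 : ∀ b : ℕ × ℕ, 1 / (b.1 : ℝ) * (1 / b.2) = F b := fun b => one_div_mul_one_div _ _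
    refine (sum_congr rfl fun b _ => e1 b).le.trans (le_trans ?_
      (sum_congr rfl fun b _ => e2 b).le)
    refine sum_le_sum_of_subset_image g (fun _ => by positivity) ?_
    rintro ⟨k, e⟩ hke
    simp only [mem_product, mem_filter, mem_Icc, mem_singleton, forall_eq, mem_insert,
      forall_eq_or_imp] at hke
    obtain ⟨⟨⟨hk1, hky⟩, hksq, hk2⟩, ⟨he1, hey⟩, hesq, he2, heh⟩ := hke
    have hcpos : 0 < k.gcd e := Nat.gcd_pos_of_pos_left _ hk1
    obtain ⟨k', hk'⟩ := Nat.gcd_dvd_left k e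
    obtain ⟨e', he'⟩ := Nat.gcd_dvd_right k e
    have hco : k'.Coprime e' := by
      have := Nat.coprime_div_gcd_div_gcd hcpos
      rwa [Nat.div_eq_of_eq_mul_right hcpos hk', Nat.div_eq_of_eq_mul_right hcpos he'] at this
    set c := k.gcd e with hc
    clear_value c
    subst hk' he'
    have hk0 : 0 < k' := Nat.pos_of_mul_pos_left hk1
    have he0 : 0 < e' := Nat.pos_of_mul_pos_left he1
    refine mem_image.2 ⟨(c, (e', k')), ?_, rfl⟩
    simp only [hQ, mem_product, mem_filter, mem_Icc]
    have hcle : c ≤ c * k' := Nat.le_mul_of_pos_right _ hk0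
    have hkle : k' ≤ c * k' := Nat.le_mul_of_pos_left _ hcpos
    have hele : e' ≤ c * e' := Nat.le_mul_of_pos_left _ hcpos
    refine ⟨⟨hcpos, by lia⟩, ⟨⟨he0, by lia⟩, hk0, by lia⟩, ?_, ?_, ?_⟩
    · exact (Nat.squarefree_mul hco.symm).2 ⟨hesq.squarefree_of_dvd (dvd_mul_left _ _),
        hksq.squarefree_of_dvd (dvd_mul_left _ _)⟩
    · refine Nat.coprime_comm.1 (Nat.prime_two.coprime_iff_not_dvd.2 fun H => ?_)
      rcases Nat.prime_two.dvd_mul.1 H with H | H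
      · exact he2 (H.mul_left _)
      · exact hk2 (H.mul_left _)
    · refine Nat.coprime_of_dvd fun p hp hpe hph => ?_
      exact heh p (Nat.mem_primeFactors.2 ⟨hp, hph, hh⟩) (hpe.mul_left _)
  have h2 : ∑ a ∈ Q, 1 / ((a.1 : ℝ) * a.2) ≤
      ∑ l ∈ (oddPrimorial (y ^ 2)).divisors with l ≤ y ^ 2, pairDensity h l := by
    rw [← sum_fiberwise_of_maps_to (s := Q) (g := fun a => a.1 * a.2)
      (t := (oddPrimorial (y ^ 2)).divisors.filter (· ≤ y ^ 2))]
    · refine sum_le_sum fun l hl => ?_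
      have hl := (mem_filter.1 hl).1
      rw [pairDensity_eq_sum h ((squarefree_oddPrimorial _).squarefree_of_dvd
        (Nat.dvd_of_mem_divisors hl))]
      refine sum_le_sum_of_subset_of_nonneg ?_ fun _ _ _ => by positivity
      intro a ha
      simp only [hQ, mem_filter, Nat.mem_divisorsAntidiagonal] at ha ⊢
      exact ⟨⟨ha.2, (Nat.pos_of_mem_divisors hl).ne'⟩, ha.1.2.2.2⟩
    · intro a ha
      simp only [hQ, mem_filter, mem_product, mem_Icc] at ha
      have hle : a.1 * a.2 ≤ y ^ 2 := by
        rw [sq]; exact Nat.mul_le_mul ha.1.1.2 ha.1.2.2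
      simp only [mem_filter, Nat.mem_divisors]
      exact ⟨⟨dvd_oddPrimorial ha.2.1 ha.2.2.1 hle, (squarefree_oddPrimorial _).ne_zero⟩, hle⟩
  have h3 : 0 ≤ ∑ a ∈ Q, 1 / ((a.1 : ℝ) * a.2) := sum_nonneg fun _ _ => by positivity
  have h4 := mul_le_mul_of_nonneg_right (sum_inv_sq_le_two y) h3
  linarith

theorem log_sq_le_selbergSum (N h y : ℕ) (hh : h ≠ 0) :
    Real.log y ^ 2 ≤ 18 * (∏ p ∈ h.primeFactors, (1 + 1 / (p : ℝ))) *
      (pairSieve N h (y ^ 2)).selbergSum (y ^ 2) := by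
  have hT : ∀ p ∈ insert 2 h.primeFactors, p.Prime := by
    intro p hp
    rcases mem_insert.1 hp with rfl | hp
    · exact Nat.prime_two
    · exact Nat.prime_of_mem_primeFactors hp
  have h1 := log_le_mul_sievedHarmonic (T := {2}) (by simp [Nat.prime_two]) y
  have h2 := log_le_mul_sievedHarmonic hT y
  have h3 := sievedHarmonic_mul_le h y hh
  have h4 := sum_pairDensity_le_selbergSum N h (y ^ 2)
  -- The prime 2 costs at most 3/2. The final 18 is 3 · 3 · 2: 2 · 3/2 from each harmonic sum and 2
  -- from the gcds.
  have hprod : ∏ p ∈ insert 2 h.primeFactors, (1 + 1 / (p : ℝ)) ≤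
      3 / 2 * ∏ p ∈ h.primeFactors, (1 + 1 / (p : ℝ)) := by
    by_cases h2 : 2 ∈ h.primeFactors
    · rw [insert_eq_of_mem h2]
      have : 0 ≤ ∏ p ∈ h.primeFactors, (1 + 1 / (p : ℝ)) := prod_nonneg fun _ _ => by positivity
      linarith
    · rw [prod_insert h2]
      norm_num
  set M := ∏ p ∈ h.primeFactors, (1 + 1 / (p : ℝ)) with hM
  have hM0 : 0 ≤ M := prod_nonneg fun _ _ => by positivity
  have hA := sievedHarmonic_nonneg {2} y
  have hB := sievedHarmonic_nonneg (insert 2 h.primeFactors) y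
  have hlog : 0 ≤ Real.log y := Real.log_natCast_nonneg y
  rw [prod_singleton] at h1
  set A := sievedHarmonic {2} y
  set B := sievedHarmonic (insert 2 h.primeFactors) y
  have h1' : Real.log y ≤ 3 * A := by push_cast at h1; linarith
  have h2' : Real.log y ≤ 3 * (M * B) := by
    have := mul_le_mul_of_nonneg_right hprod hB
    linarith
  calc Real.log y ^ 2 = Real.log y * Real.log y := sq _
    _ ≤ (3 * A) * (3 * (M * B)) := by gcongr
    _ = 9 * M * (A * B) := by ring
    _ ≤ 9 * M * (2 * (pairSieve N h (y ^ 2)).selbergSum (y ^ 2)) := by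
        refine mul_le_mul_of_nonneg_left ?_ (by positivity)
        linarith
    _ = _ := by ring

/-! ### The product of 1 + 1/p over the primes dividing h -/

/-- For p = 2i + 1, (1 + 1/p)² ≤ (i + 1)/i because 4i(i + 1) ≤ (2i + 1)², and the right-hand sides
telescope. Only oddness matters, not primality. -/
theorem prod_odd_one_add_inv_sq_le {S : Finset ℕ} {K : ℕ} (hK : ∀ p ∈ S, p ≤ K)
    (hodd : ∀ p ∈ S, 3 ≤ p ∧ p % 2 = 1) :
    ∏ p ∈ S, (1 + 1 / (p : ℝ)) ^ 2 ≤ ((K / 2 : ℕ) : ℝ) + 1 := by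
  have htel : ∀ n : ℕ, ∏ i ∈ Icc 1 n, (((i : ℝ) + 1) / i) = n + 1 := by
    intro n
    induction n with
    | zero => simp
    | succ n ih =>
      rw [prod_Icc_succ_top (by lia), ih]
      push_cast
      field_simp
  have hinj : Set.InjOn (fun p : ℕ => p / 2) (S : Set ℕ) := by
    intro p hp q hq hpq
    have h1 := hodd p hp
    have h2 := hodd q hq
    simp only at hpq
    lia
  calc ∏ p ∈ S, (1 + 1 / (p : ℝ)) ^ 2
      ≤ ∏ p ∈ S, ((((p / 2 : ℕ) : ℝ) + 1) / ((p / 2 : ℕ) : ℝ)) := by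
        refine prod_le_prod (fun _ _ => by positivity) fun p hp => ?_
        obtain ⟨h3, ho⟩ := hodd p hp
        obtain ⟨i, hi⟩ : ∃ i, p = 2 * i + 1 := ⟨p / 2, by lia⟩
        have hi1 : 1 ≤ i := by lia
        have e : p / 2 = i := by lia
        have hi0 : (1 : ℝ) ≤ i := by exact_mod_cast hi1
        rw [e, hi]
        push_cast
        rw [show (1 + 1 / (2 * (i : ℝ) + 1)) ^ 2 = (2 * i + 2) ^ 2 / (2 * i + 1) ^ 2 by
          field_simp; ring]
        rw [div_le_div_iff₀ (by positivity) (by positivity)]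
        nlinarith
    _ = ∏ i ∈ S.image (fun p : ℕ => p / 2), (((i : ℝ) + 1) / i) := by
        rw [prod_image hinj]
    _ ≤ ∏ i ∈ Icc 1 (K / 2), (((i : ℝ) + 1) / i) := by
        refine prod_le_prod_of_subset_of_one_le (R := ℝ) ?_ (fun _ _ => by positivity) ?_
        · intro i hi
          obtain ⟨p, hp, rfl⟩ := mem_image.1 hi
          have := hK p hp
          have := hodd p hp
          simp only [mem_Icc]
          lia
        · intro i hi _
          have : (1 : ℝ) ≤ i := by exact_mod_cast (mem_Icc.1 hi).1
          rw [one_le_div (by linarith)]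
          linarith
    _ = _ := htel _

/-- There are at most `K` prime factors, so those above `K` contribute at most (1 + 1/K)^K ≤ e < 3.
Those up to `K` are handled by telescoping over odd numbers, with 2 treated apart. -/
theorem prod_primeFactors_one_add_inv_sq_le {m K : ℕ} (hm : m ≠ 0) (hK : 1 ≤ K)
    (hmK : m ≤ 2 ^ K) :
    (∏ p ∈ m.primeFactors, (1 + 1 / (p : ℝ))) ^ 2 ≤ 27 * K := by
  have hcard : #m.primeFactors ≤ K := by
    have h1 : 2 ^ #m.primeFactors ≤ ∏ p ∈ m.primeFactors, p := by
      rw [← prod_const]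
      exact prod_le_prod' fun p hp => (Nat.prime_of_mem_primeFactors hp).two_le
    have h2 := Nat.le_of_dvd (Nat.pos_of_ne_zero hm) (Nat.prod_primeFactors_dvd m)
    exact (Nat.pow_le_pow_iff_right (by norm_num)).1 (h1.trans (h2.trans hmK))
  have hK0 : (0 : ℝ) < K := by exact_mod_cast hK
  have hK1 : (1 : ℝ) ≤ K := by exact_mod_cast hK
  have hlarge : ∏ p ∈ m.primeFactors with ¬ p ≤ K, (1 + 1 / (p : ℝ)) ≤ 3 := by
    calc ∏ p ∈ m.primeFactors with ¬ p ≤ K, (1 + 1 / (p : ℝ))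
        ≤ ∏ p ∈ m.primeFactors with ¬ p ≤ K, Real.exp (1 / K) := by
          refine prod_le_prod (fun _ _ => by positivity) fun p hp => ?_
          have hp' : (K : ℝ) ≤ p := by exact_mod_cast (not_le.1 (mem_filter.1 hp).2).le
          have h1 : 1 / (p : ℝ) ≤ 1 / K := one_div_le_one_div_of_le hK0 hp'
          have h2 := Real.add_one_le_exp (1 / (K : ℝ))
          linarith
      _ = Real.exp (#{p ∈ m.primeFactors | ¬ p ≤ K} * (1 / K)) := by
          rw [prod_const, Real.exp_nat_mul]
      _ ≤ Real.exp 1 := by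
          refine Real.exp_le_exp.2 ?_
          rw [mul_one_div, div_le_one hK0]
          exact_mod_cast (card_filter_le _ _).trans hcard
      _ ≤ 3 := by
          have := Real.exp_one_lt_d9
          linarith
  have hsmall : (∏ p ∈ m.primeFactors with p ≤ K, (1 + 1 / (p : ℝ))) ^ 2 ≤ 3 * K := by
    set S : Finset ℕ := {p ∈ m.primeFactors | p ≤ K ∧ p ≠ 2} with hS
    have hsub : {p ∈ m.primeFactors | p ≤ K} ⊆ insert 2 S := by
      intro p hp
      simp only [hS, mem_filter, mem_insert] at hp ⊢
      tauto
    have h2S : 2 ∉ S := by simp [hS]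
    have h1 : ∏ p ∈ m.primeFactors with p ≤ K, (1 + 1 / (p : ℝ)) ^ 2 ≤
        9 / 4 * (((K / 2 : ℕ) : ℝ) + 1) := by
      refine (prod_le_prod_of_subset_of_one_le (R := ℝ) hsub (fun _ _ => by positivity)
        fun i _ _ => ?_).trans ?_
      · exact one_le_pow₀ (le_add_of_nonneg_right (by positivity))
      rw [prod_insert h2S]
      have hodd := prod_odd_one_add_inv_sq_le (S := S) (K := K)
        (fun p hp => (mem_filter.1 hp).2.1) (fun p hp => by
          have h := mem_filter.1 hp
          have hpp := Nat.prime_of_mem_primeFactors h.1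
          have := hpp.two_le
          have := hpp.eq_two_or_odd
          have := h.2.2
          lia)
      push_cast at hodd ⊢
      nlinarith
    rw [← prod_pow]
    by_cases hK1' : K = 1
    · have : {p ∈ m.primeFactors | p ≤ K} = ∅ := by
        refine filter_eq_empty_iff.2 fun p hp => ?_
        have := (Nat.prime_of_mem_primeFactors hp).two_le
        lia
      rw [this, hK1']
      norm_num
    by_cases hK2 : K = 2
    · subst hK2; norm_num at h1 ⊢; linarith
    have : (((K / 2 : ℕ) : ℝ)) ≤ K / 2 := Nat.cast_div_le
    have hK3 : (3 : ℝ) ≤ K := by exact_mod_cast (by lia : 3 ≤ K)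
    linarith
  rw [← prod_filter_mul_prod_filter_not _ (fun p => p ≤ K), mul_pow]
  have h0 : 0 ≤ ∏ p ∈ m.primeFactors with ¬ p ≤ K, (1 + 1 / (p : ℝ)) :=
    prod_nonneg fun _ _ => by positivity
  calc _ ≤ 3 * (K : ℝ) * 3 ^ 2 := by gcongr
    _ = _ := by ring

/-! ### Prime pairs with a given difference -/

/-- The number of prime pairs `(p, p + h)` with `p ≤ N` is `O(N / (log N) ^ (3 / 2))`, uniformly
in `1 ≤ h ≤ N`. -/
theorem card_prime_pairs_le {N h : ℕ} (hh : 1 ≤ h) (hhN : h ≤ N) (hN : 2 ≤ N) :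
    (#{n ∈ Ioc 0 N | n.Prime ∧ (n + h).Prime} : ℝ) ≤
      400000 * (N / (Real.log N * √(Real.log N))) := by
  have hN0 : (0 : ℝ) < N := by exact_mod_cast (by lia : 0 < N)
  have hL0 : 0 < Real.log N := Real.log_pos (by exact_mod_cast (by lia : 1 < N))
  set L := Real.log N with hL
  have hs0 : 0 < √L := Real.sqrt_pos.2 hL0
  by_cases hbig : N < 2 ^ 24
  · have h1 : (#{n ∈ Ioc 0 N | n.Prime ∧ (n + h).Prime} : ℝ) ≤ N := by
      have := card_filter_le (Ioc 0 N) fun n => n.Prime ∧ (n + h).Prime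
      rw [Nat.card_Ioc] at this
      exact_mod_cast this
    have h2 : L ≤ 25 := by
      have h3 : L ≤ Real.log ((2 : ℝ) ^ 24) :=
        Real.log_le_log hN0 (by exact_mod_cast hbig.le)
      rw [Real.log_pow] at h3
      have := Real.log_two_lt_d9
      push_cast at h3
      linarith
    have h3 : √L ≤ 5 := by
      rw [Real.sqrt_le_left (by norm_num)]
      linarith
    have h4 : L * √L ≤ 125 := by nlinarith
    refine h1.trans ?_
    rw [← mul_div_assoc, le_div_iff₀ (by positivity)]
    nlinarith
  · have hbig' : (2 : ℝ) ^ 24 ≤ N := by exact_mod_cast not_lt.1 hbig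
    have hroot : ((N : ℝ) ^ ((24 : ℕ) : ℝ)⁻¹) ^ 24 = N :=
      Real.rpow_inv_natCast_pow hN0.le (by norm_num)
    have hr0 : 0 ≤ (N : ℝ) ^ ((24 : ℕ) : ℝ)⁻¹ := by positivity
    set r := (N : ℝ) ^ ((24 : ℕ) : ℝ)⁻¹ with hr
    -- With level z = y², the sieve error z⁶ = y¹² is at most √N when y ≤ N^(1/24).
    set y := ⌊r⌋₊ with hy
    have hr2 : 2 ≤ r := by
      by_contra! H
      have := pow_lt_pow_left₀ H hr0 (n := 24) (by norm_num)
      linarith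
    have hy2 : 2 ≤ y := Nat.le_floor (by exact_mod_cast hr2)
    have hy2' : (2 : ℝ) ≤ y := by exact_mod_cast hy2
    have hyr : (y : ℝ) ≤ r := Nat.floor_le hr0
    have hry : r < y + 1 := Nat.lt_floor_add_one r
    have hy24 : (y : ℝ) ^ 24 ≤ N := hroot ▸ pow_le_pow_left₀ (by positivity) hyr 24
    have hlogy : L ≤ 48 * Real.log y := by
      have h1 : L = 24 * Real.log r := by
        rw [hL, ← hroot, Real.log_pow]
        norm_num
      have h2 : Real.log r ≤ Real.log ((y : ℝ) ^ 2) :=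
        Real.log_le_log (by linarith) (by nlinarith)
      rw [Real.log_pow] at h2
      push_cast at h2
      linarith
    have hL1 : 1 ≤ L := by
      have h3 : Real.log ((2 : ℝ) ^ 24) ≤ L := Real.log_le_log (by positivity) hbig'
      rw [Real.log_pow] at h3
      have := Real.log_two_gt_d9
      push_cast at h3
      linarith
    have hM : ∏ p ∈ h.primeFactors, (1 + 1 / (p : ℝ)) ≤ 9 * √L := by
      have h1 := prod_primeFactors_one_add_inv_sq_le (m := h) (K := Nat.log 2 N + 1) (by lia)
        (by lia) (hhN.trans (Nat.lt_pow_succ_log_self (by norm_num) N).le)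
      have h2 : ((Nat.log 2 N : ℕ) : ℝ) * Real.log 2 ≤ L := by
        rw [← Real.log_pow]
        exact Real.log_le_log (by positivity)
          (by exact_mod_cast Nat.pow_log_le_self 2 (by lia))
      have h3 := Real.log_two_gt_d9
      have h4 : ((Nat.log 2 N : ℕ) : ℝ) ≤ 2 * L := by
        have : (0 : ℝ) ≤ (Nat.log 2 N : ℕ) := by positivity
        nlinarith
      refine abs_le_of_sq_le_sq' ?_ (by positivity) |>.2
      rw [mul_pow, Real.sq_sqrt hL0.le]
      push_cast at h1
      linarith
    have hG := (pairSieve N h (y ^ 2)).selbergSum_pos (z := y ^ 2) (Nat.one_le_pow _ _ (by lia))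
    have hsum := log_sq_le_selbergSum N h y (by lia)
    have hmain := card_prime_pairs_le_selberg N h (z := y ^ 2) (Nat.one_le_pow _ _ (by lia))
    generalize (pairSieve N h (y ^ 2)).selbergSum (y ^ 2) = G at hG hsum hmain
    generalize ∏ p ∈ h.primeFactors, (1 + 1 / (p : ℝ)) = M at hM hsum
    -- 373248 = 48² · 18 · 9, from L ≤ 48 log y, the Selberg sum bound and M ≤ 9√L.
    have hG' : L * √L ≤ 373248 * G := by
      have h1 : L ^ 2 ≤ 48 ^ 2 * (18 * (9 * √L) * G) := by
        calc L ^ 2 ≤ (48 * Real.log y) ^ 2 := by gcongr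
          _ = 48 ^ 2 * Real.log y ^ 2 := by ring
          _ ≤ 48 ^ 2 * (18 * M * G) := by gcongr
          _ ≤ _ := by gcongr
      refine le_of_mul_le_mul_right ?_ hs0
      calc L * √L * √L = L ^ 2 := by rw [mul_assoc, Real.mul_self_sqrt hL0.le, sq]
        _ ≤ _ := h1
        _ = _ := by ring
    have h1 : N / G ≤ 373248 * (N / (L * √L)) := by
      rw [← mul_div_assoc, div_le_div_iff₀ hG (by positivity)]
      nlinarith
    have hsqrt : (y : ℝ) ^ 12 ≤ √N := by
      refine Real.le_sqrt_of_sq_le ?_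
      rw [← pow_mul]
      exact hy24
    have h2 : √(N : ℝ) ≤ 3 * (N / (L * √L)) := by
      have h3 : L ^ 3 ≤ 9 * N := by
        have := Real.pow_div_factorial_le_exp L hL0.le 3
        rw [hL, Real.exp_log hN0, ← hL] at this
        norm_num [Nat.factorial] at this
        linarith
      have h4 : L * √L ≤ 3 * √N := by
        refine abs_le_of_sq_le_sq' ?_ (by positivity) |>.2
        rw [mul_pow, mul_pow, Real.sq_sqrt hL0.le, Real.sq_sqrt hN0.le]
        linarith
      rw [← mul_div_assoc, le_div_iff₀ (by positivity)]
      calc √(N : ℝ) * (L * √L) ≤ √N * (3 * √N) := by gcongr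
        _ = 3 * (√N * √N) := by ring
        _ = 3 * N := by rw [Real.mul_self_sqrt hN0.le]
    have h3 : (y : ℝ) ^ 2 ≤ (y : ℝ) ^ 12 := pow_le_pow_right₀ (by linarith) (by norm_num)
    have h4 : ((y : ℝ) ^ 2) ^ 6 = (y : ℝ) ^ 12 := by ring
    push_cast at hmain
    have h5 : 0 ≤ N / (L * √L) := by positivity
    linarith

/-! ### Chebyshev bounds -/

theorem primeCounting_floor_le {x : ℝ} (hx : 3 ≤ x) :
    (Nat.primeCounting ⌊x⌋₊ : ℝ) ≤ 5 * (x / Real.log x) := by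
  have hL : 0 < Real.log x := Real.log_pos (by linarith)
  have h := Chebyshev.pi_le_log4_mul_div (x := x) (by linarith)
  rw [Real.log_sqrt (by linarith)] at h
  have h4 : Real.log 4 ≤ 1.4 := by
    rw [show (4 : ℝ) = 2 ^ 2 by norm_num, Real.log_pow]
    have := Real.log_two_lt_d9
    push_cast
    linarith
  have hs0 : 0 < √x := Real.sqrt_pos.2 (by linarith)
  have hlog : Real.log x ≤ 2 * √x := by
    have h1 := Real.log_le_sub_one_of_pos hs0
    rw [Real.log_sqrt (by linarith)] at h1
    linarith
  have hsx : √x * √x = x := Real.mul_self_sqrt (by linarith)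
  have h1 : √x ≤ 2 * (x / Real.log x) := by
    rw [← mul_div_assoc, le_div_iff₀ hL]
    nlinarith
  have h2 : Real.log 4 * x / (Real.log x / 2) ≤ 2.8 * (x / Real.log x) := by
    rw [← mul_div_assoc, div_le_div_iff₀ (by positivity) hL]
    have : 0 < x * Real.log x := by positivity
    nlinarith
  have h3 : 0 ≤ x / Real.log x := by positivity
  linarith

theorem div_log_le_primeCounting {n : ℕ} (hn : 2 ≤ n) :
    (n : ℝ) / (10 * Real.log n) ≤ Nat.primeCounting n := by
  have hL : 0 < Real.log n := Real.log_pos (by exact_mod_cast (by lia : 1 < n))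
  have h2 := Real.log_two_gt_d9
  -- By induction: log(n + 1) grows by at most 1/3 per step, less than log 2 - 1/10.
  have key : (n : ℝ) / 10 ≤ n * Real.log 2 - Real.log (n + 1) := by
    induction n, hn using Nat.le_induction with
    | base =>
      have h3 : Real.log 3 ≤ 1.15 := by
        have h := Real.log_le_sub_one_of_pos (x := 3 / 4) (by norm_num)
        rw [Real.log_div (by norm_num) (by norm_num),
          show (4 : ℝ) = 2 ^ 2 by norm_num, Real.log_pow] at h
        have := Real.log_two_lt_d9
        push_cast at h
        linarith
      norm_num at h3 ⊢
      linarith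
    | succ n hn ih =>
      have ih := ih (Real.log_pos (by exact_mod_cast (by lia : 1 < n)))
      have hn' : (2 : ℝ) ≤ n := by exact_mod_cast hn
      have h := Real.log_le_sub_one_of_pos (x := ((n : ℝ) + 1 + 1) / (n + 1)) (by positivity)
      rw [Real.log_div (by positivity) (by positivity)] at h
      have : ((n : ℝ) + 1 + 1) / (n + 1) - 1 ≤ 1 / 3 := by
        rw [show ((n : ℝ) + 1 + 1) / (n + 1) - 1 = 1 / (n + 1) by field_simp; ring]
        exact one_div_le_one_div_of_le (by norm_num) (by linarith)
      push_cast
      linarith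
  have h := Chebyshev.pi_ge n
  refine le_trans ?_ h
  rw [← div_div]
  gcongr

/-! ### Second moment inequality and the upper bound -/

/-- The Cauchy–Schwarz lower bound for the size of a union. -/
theorem sq_sum_card_le_card_biUnion_mul {ι α : Type*} [DecidableEq α] (s : Finset ι)
    (E : ι → Finset α) :
    (∑ i ∈ s, (#(E i) : ℝ)) ^ 2 ≤
      #(s.biUnion E) * ∑ i ∈ s, ∑ j ∈ s, (#(E i ∩ E j) : ℝ) := by
  have hind : ∀ F ⊆ s.biUnion E, (#F : ℝ) = ∑ n ∈ s.biUnion E, if n ∈ F then (1 : ℝ) else 0 := by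
    intro F hF
    rw [← sum_filter, sum_const, nsmul_one, filter_mem_eq_inter, inter_eq_right.2 hF]
  have h1 : ∑ i ∈ s, (#(E i) : ℝ) =
      ∑ n ∈ s.biUnion E, ∑ i ∈ s, if n ∈ E i then (1 : ℝ) else 0 := by
    rw [sum_comm]
    exact sum_congr rfl fun i hi => hind _ (subset_biUnion_of_mem E hi)
  have h2 : ∑ i ∈ s, ∑ j ∈ s, (#(E i ∩ E j) : ℝ) =
      ∑ n ∈ s.biUnion E, (∑ i ∈ s, if n ∈ E i then (1 : ℝ) else 0) ^ 2 := by
    simp_rw [sq, sum_mul_sum]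
    rw [sum_comm]
    refine (sum_congr rfl fun i hi => ?_).trans sum_comm
    refine (sum_congr rfl fun j hj => ?_).trans sum_comm
    rw [hind _ (inter_subset_left.trans (subset_biUnion_of_mem E hj))]
    refine sum_congr rfl fun n _ => ?_
    by_cases ha : n ∈ E i <;> by_cases hb : n ∈ E j <;> simp [ha, hb]
  rw [h1, h2]
  exact sq_sum_le_card_mul_sum_sq

/-- Puts the target in the form R · (x/L), so that the counting lemmas need only R^b = L. -/
theorem div_rpow_one_sub_one_div {L : ℝ} (hL : 0 < L) (x : ℝ) (b : ℕ) :
    x / L ^ (1 - 1 / (b : ℝ)) = L ^ (1 / (b : ℝ)) * (x / L) := by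
  rw [Real.rpow_sub hL, Real.rpow_one]
  have : 0 < L ^ (1 / (b : ℝ)) := Real.rpow_pos_of_pos hL _
  field_simp

/-- The integers up to `x` of the form `p + a ^ (j ^ b)` with `p` prime. -/
abbrev primeAddPowSet (a b : ℕ) (x : ℝ) : Set ℕ :=
  {n : ℕ | 1 ≤ n ∧ (n : ℝ) ≤ x ∧ ∃ p j : ℕ, p.Prime ∧ p + a ^ (j ^ b) = n}

theorem finite_primeAddPowSet (a b : ℕ) (x : ℝ) : (primeAddPowSet a b x).Finite :=
  (Set.finite_Iic ⌊x⌋₊).subset fun _ hn => Nat.le_floor hn.2.1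

theorem ncard_primeAddPowSet_le {a b : ℕ} (ha : 2 ≤ a) (hb : 2 ≤ b) {x : ℝ} (hx : 3 ≤ x) {R : ℝ}
    (hR1 : 1 ≤ R) (hR : R ^ b = Real.log x) :
    ((primeAddPowSet a b x).ncard : ℝ) ≤ 15 * (R * (x / Real.log x)) := by
  have hL : 0 < Real.log x := Real.log_pos (by linarith)
  set J := ⌊2 * R⌋₊
  have hsub : primeAddPowSet a b x ⊆ (((Nat.primesLE ⌊x⌋₊) ×ˢ range (J + 1)).image
      fun q : ℕ × ℕ => q.1 + a ^ (q.2 ^ b) : Finset ℕ) := by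
    rintro n ⟨_, hnx, p, j, hp, rfl⟩
    push_cast at hnx
    have hA : (0 : ℝ) < (a : ℝ) ^ j ^ b := by
      have : (0 : ℝ) < a := by exact_mod_cast (by lia : 0 < a)
      positivity
    have hpx : (p : ℝ) ≤ x := by linarith
    have hax : (2 : ℝ) ^ j ^ b ≤ x := by
      have h1 : (2 : ℝ) ^ j ^ b ≤ (a : ℝ) ^ j ^ b := by
        gcongr
        exact_mod_cast ha
      have : (0 : ℝ) ≤ p := by positivity
      linarith
    -- Here j^b ≤ L / log 2 ≤ 2L ≤ (2R)^b.
    have hj : (j : ℝ) ≤ 2 * R := by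
      have h1 := Real.log_le_log (by positivity) hax
      rw [Real.log_pow] at h1
      have h2 := Real.log_two_gt_d9
      have h3 : ((j ^ b : ℕ) : ℝ) ≤ 2 * Real.log x := by
        have : (0 : ℝ) ≤ (j ^ b : ℕ) := by positivity
        nlinarith
      refine (pow_le_pow_iff_left₀ (by positivity) (by positivity) (by lia : b ≠ 0)).1 ?_
      rw [mul_pow, hR]
      push_cast at h3
      have h4 : (2 : ℝ) ≤ 2 ^ b := le_self_pow₀ (by norm_num) (by lia)
      nlinarith
    rw [mem_coe, mem_image]
    refine ⟨(p, j), ?_, rfl⟩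
    rw [mem_product, Nat.mem_primesLE, mem_range]
    exact ⟨⟨Nat.le_floor hpx, hp⟩, Nat.lt_succ_of_le (Nat.le_floor hj)⟩
  have h1 := (Set.ncard_le_ncard hsub (finite_toSet _)).trans
    ((Set.ncard_coe_finset _).le.trans card_image_le)
  rw [card_product, card_range] at h1
  have h2 : ((primeAddPowSet a b x).ncard : ℝ) ≤ #(Nat.primesLE ⌊x⌋₊) * ((J : ℝ) + 1) := by
    exact_mod_cast h1
  have h3 : (#(Nat.primesLE ⌊x⌋₊) : ℝ) ≤ 5 * (x / Real.log x) := by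
    simpa using primeCounting_floor_le hx
  have h4 : (J : ℝ) ≤ 2 * R := Nat.floor_le (by linarith)
  have h5 : 0 ≤ x / Real.log x := div_nonneg (by linarith) hL.le
  calc _ ≤ _ := h2
    _ ≤ 5 * (x / Real.log x) * (3 * R) := by
        gcongr
        linarith
    _ = _ := by ring

theorem one_le_ncard_primeAddPowSet (a : ℕ) {b : ℕ} (hb : b ≠ 0) {x : ℝ} (hx : 3 ≤ x) :
    1 ≤ (primeAddPowSet a b x).ncard := by
  rw [Nat.one_le_iff_ne_zero, ← Nat.pos_iff_ne_zero,
    Set.ncard_pos (finite_primeAddPowSet a b x)]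
  refine ⟨3, by norm_num, by exact_mod_cast hx, 2, 0, Nat.prime_two, ?_⟩
  simp [hb]

/-! ### The lower bound -/

theorem card_shifted_primes_inter_le {N A B : ℕ} (hAB : A < B) (hB : B ≤ N) (hN : 2 ≤ N) :
    (#((Nat.primesLE N).image (· + A) ∩ (Nat.primesLE N).image (· + B)) : ℝ) ≤
      400000 * (N / (Real.log N * √(Real.log N))) := by
  refine le_trans ?_ (card_prime_pairs_le (h := B - A) (by lia) (by lia) hN)
  have hsub : (Nat.primesLE N).image (· + A) ∩ (Nat.primesLE N).image (· + B) ⊆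
      {n ∈ Ioc 0 N | n.Prime ∧ (n + (B - A)).Prime}.image (· + B) := by
    intro n hn
    simp only [mem_inter, mem_image, Nat.mem_primesLE] at hn
    obtain ⟨⟨p, ⟨-, hp⟩, hpn⟩, q, ⟨hqN, hq⟩, hqn⟩ := hn
    refine mem_image.2 ⟨q, ?_, hqn⟩
    simp only [mem_filter, mem_Ioc]
    refine ⟨⟨hq.pos, hqN⟩, hq, ?_⟩
    rwa [show q + (B - A) = p by lia]
  exact_mod_cast (card_le_card hsub).trans card_image_le

/-- Dividing `R` by `a` gives j^b · a^b ≤ log x, and 2 log a ≤ a² ≤ a^b, so the power is at most √x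
≤ x/2. -/
theorem pow_le_half_of_le_div {a b j : ℕ} (ha : 2 ≤ a) (hb : 2 ≤ b) {x R : ℝ} (hx : 4 ≤ x)
    (hR : R ^ b = Real.log x) (hj : (j : ℝ) ≤ R / a) : ((a ^ j ^ b : ℕ) : ℝ) ≤ x / 2 := by
  have ha2 : (2 : ℝ) ≤ a := by exact_mod_cast ha
  have hL : 0 < Real.log x := Real.log_pos (by linarith)
  have h1 : (j : ℝ) ^ b * a ^ b ≤ Real.log x := by
    rw [← hR, ← mul_pow]
    gcongr
    rwa [← le_div_iff₀ (by linarith)]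
  have h2 : (a : ℝ) ^ 2 ≤ a ^ b := pow_le_pow_right₀ (by linarith) hb
  have h3 : Real.log a ≤ a := Real.log_le_self (by linarith)
  have hjb : (0 : ℝ) ≤ (j : ℝ) ^ b := by positivity
  have h4 : Real.log ((a : ℝ) ^ j ^ b) ≤ Real.log √x := by
    rw [Real.log_pow, Real.log_sqrt (by linarith), le_div_iff₀ (by norm_num)]
    push_cast
    calc (j : ℝ) ^ b * Real.log a * 2 ≤ (j : ℝ) ^ b * a * a := by gcongr
      _ = (j : ℝ) ^ b * a ^ 2 := by ring
      _ ≤ (j : ℝ) ^ b * a ^ b := by gcongr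
      _ ≤ _ := h1
  have hs0 : 0 < √x := Real.sqrt_pos.2 (by linarith)
  have h5 := (Real.log_le_log_iff (by positivity) hs0).1 h4
  have h6 : (2 : ℝ) ≤ √x := Real.le_sqrt_of_sq_le (by linarith)
  have h7 : √x * √x = x := Real.mul_self_sqrt (by linarith)
  push_cast
  nlinarith

theorem sum_card_inter_le {α : Type*} [DecidableEq α] {J M : ℕ} {D F : ℝ} {E : ℕ → Finset α}
    (hF : 0 ≤ F) (hE : ∀ i, #(E i) = M) (hD : M ≤ D)
    (hoff : ∀ i ∈ range J, ∀ j ∈ range J, i < j → (#(E i ∩ E j) : ℝ) ≤ F) :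
    ∑ i ∈ range J, ∑ j ∈ range J, (#(E i ∩ E j) : ℝ) ≤ J * D + J * (J * F) := by
  have hterm : ∀ i ∈ range J, ∀ j ∈ range J, (#(E i ∩ E j) : ℝ) ≤
      (if i = j then D else 0) + F := by
    intro i hi j hj
    rcases lt_trichotomy i j with h | h | h
    · rw [if_neg h.ne, zero_add]; exact hoff i hi j hj h
    · subst h
      rw [if_pos rfl, inter_self, hE]
      linarith
    · rw [if_neg h.ne', zero_add, inter_comm]; exact hoff j hj i hi h
  have hrow : ∀ i ∈ range J, ∑ j ∈ range J, ((if i = j then D else 0) + F) = D + J * F := by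
    intro i hi
    rw [sum_add_distrib, sum_ite_eq, if_pos hi, sum_const, card_range, nsmul_eq_mul]
  refine (sum_le_sum fun i hi => sum_le_sum fun j hj => hterm i hi j hj).trans ?_
  rw [sum_congr rfl hrow, sum_const, card_range, nsmul_eq_mul, mul_add]

theorem primes_le_half_bounds {x : ℝ} (hx : 16 ≤ x) :
    2 ≤ ⌊x / 2⌋₊ ∧ Real.log x / 2 ≤ Real.log ⌊x / 2⌋₊ ∧
    (#(Nat.primesLE ⌊x / 2⌋₊) : ℝ) ≤ 5 * (x / Real.log x) ∧
    x / Real.log x ≤ 40 * #(Nat.primesLE ⌊x / 2⌋₊) := by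
  have hL : 0 < Real.log x := Real.log_pos (by linarith)
  set L := Real.log x with hLdef
  set N := ⌊x / 2⌋₊ with hN
  have hNx : (N : ℝ) ≤ x / 2 := Nat.floor_le (by linarith)
  have hxN : x / 2 < N + 1 := Nat.lt_floor_add_one _
  have hN2' : (2 : ℝ) ≤ N := by linarith
  have hN2 : 2 ≤ N := by exact_mod_cast hN2'
  have hlogN : L / 2 ≤ Real.log N := by
    rw [hLdef, ← Real.log_sqrt (by linarith)]
    refine Real.log_le_log (Real.sqrt_pos.2 (by linarith)) ?_
    rw [Real.sqrt_le_left (by linarith)]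
    nlinarith
  have hlogN' : Real.log N ≤ L := Real.log_le_log (by linarith) (by linarith)
  set P := Nat.primesLE N with hP
  have hPup : (#P : ℝ) ≤ 5 * (x / L) := by
    have h1 := primeCounting_floor_le (x := x) (by linarith)
    have h2 : Nat.primeCounting N ≤ Nat.primeCounting ⌊x⌋₊ :=
      Nat.monotone_primeCounting (Nat.floor_le_floor (by linarith))
    have h3 : #P = Nat.primeCounting N := by simp [hP]
    rw [h3]
    exact le_trans (by exact_mod_cast h2) h1
  have hPlow : x / L ≤ 40 * #P := by
    have h1 := div_log_le_primeCounting hN2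
    have h3 : #P = Nat.primeCounting N := by simp [hP]
    rw [h3]
    have hlogN0 : 0 < Real.log N := by linarith
    have h4 : x / L ≤ 40 * ((N : ℝ) / (10 * Real.log N)) := by
      rw [← mul_div_assoc, div_le_div_iff₀ hL (by positivity)]
      calc x * (10 * Real.log N) ≤ x * (10 * L) := by gcongr
        _ = (10 * x) * L := by ring
        _ ≤ 40 * N * L := mul_le_mul_of_nonneg_right (by linarith) hL.le
    linarith
  exact ⟨hN2, hlogN, hPup, hPlow⟩

theorem le_ncard_primeAddPowSet {a b : ℕ} (ha : 2 ≤ a) (hb : 2 ≤ b) {x : ℝ} (hx : 16 ≤ x) {R : ℝ}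
    (hR1 : 1 ≤ R) (hR : R ^ b = Real.log x) :
    R * (x / Real.log x) ≤ 4800000000 * a * ((primeAddPowSet a b x).ncard : ℝ) := by
  have hL : 0 < Real.log x := Real.log_pos (by linarith)
  have ha2 : (2 : ℝ) ≤ a := by exact_mod_cast ha
  set L := Real.log x with hLdef
  obtain ⟨hN2, hlogN, hPup, hPlow⟩ := primes_le_half_bounds hx
  rw [← hLdef] at hlogN hPup hPlow
  have hNx : (⌊x / 2⌋₊ : ℝ) ≤ x / 2 := Nat.floor_le (by linarith)
  set N := ⌊x / 2⌋₊ with hN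
  have hsL : 0 < √L := Real.sqrt_pos.2 hL
  have hRL : R ≤ √L := by
    refine Real.le_sqrt_of_sq_le ?_
    rw [← hR]
    exact pow_le_pow_right₀ hR1 hb
  -- The shifts are 0 ≤ j ≤ R/a; counting j = 0 ensures J ≥ R/a even when R < a.
  set J := ⌊R / a⌋₊ + 1 with hJ
  have hRa : 0 ≤ R / a := by positivity
  have hJ1 : R / a ≤ J := by
    have := (Nat.lt_floor_add_one (R / a)).le
    rw [hJ]; exact_mod_cast this
  have hJ2 : (J : ℝ) ≤ 2 * R := by
    have h1 := Nat.floor_le hRa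
    have h2 : R / a ≤ R := div_le_self (by linarith) (by linarith)
    rw [hJ]; push_cast; linarith
  have hJ0 : (0 : ℝ) < J := by rw [hJ]; positivity
  have hpow : ∀ j ∈ range J, a ^ j ^ b ≤ N := by
    intro j hj
    rw [mem_range, hJ, Nat.lt_succ_iff] at hj
    exact Nat.le_floor (pow_le_half_of_le_div ha hb (by linarith) hR
      ((Nat.le_floor_iff hRa).1 hj))
  set P := Nat.primesLE N with hP
  let E : ℕ → Finset ℕ := fun j => P.image (· + a ^ j ^ b)
  have hE : ∀ j, #(E j) = #P := fun j => card_image_of_injective _ (add_left_injective _)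
  have hoff : ∀ i ∈ range J, ∀ j ∈ range J, i < j →
      (#(E i ∩ E j) : ℝ) ≤ 1000000 * (x / (L * √L)) := by
    intro i hi j hj hij
    have hlt : a ^ i ^ b < a ^ j ^ b :=
      Nat.pow_lt_pow_right (by lia) (Nat.pow_lt_pow_left hij (by lia))
    refine (card_shifted_primes_inter_le hlt (hpow j hj) hN2).trans ?_
    have hs : √L / 2 ≤ √(Real.log N) := by
      refine Real.le_sqrt_of_sq_le ?_
      rw [div_pow, Real.sq_sqrt hL.le]
      linarith
    have h1 : L * √L ≤ 4 * (Real.log N * √(Real.log N)) := by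
      have := mul_le_mul hlogN hs (by positivity) (by linarith)
      linarith
    have h2 : 0 < Real.log N * √(Real.log N) := by
      have : 0 < L * √L := by positivity
      linarith
    rw [← mul_div_assoc, ← mul_div_assoc, div_le_div_iff₀ h2 (by positivity)]
    calc 400000 * (N : ℝ) * (L * √L) ≤ 400000 * (x / 2) *
          (4 * (Real.log N * √(Real.log N))) := by gcongr
      _ = 800000 * (x * (Real.log N * √(Real.log N))) := by ring
      _ ≤ 1000000 * (x * (Real.log N * √(Real.log N))) := by gcongr; norm_num
      _ = _ := by ring
  have hsum : ∑ i ∈ range J, ∑ j ∈ range J, (#(E i ∩ E j) : ℝ) ≤ 3000000 * (J * (x / L)) := by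
    have hF : 0 ≤ 1000000 * (x / (L * √L)) := by positivity
    calc _ ≤ J * (5 * (x / L)) + J * (J * (1000000 * (x / (L * √L)))) :=
        sum_card_inter_le hF hE hPup hoff
      -- One factor J ≤ 2R ≤ 2√L cancels the √L of the pair bound; R ≤ √L is where b ≥ 2 is
      -- essential.
      _ ≤ J * (5 * (x / L)) + J * (2 * √L * (1000000 * (x / (L * √L)))) := by
        gcongr
        linarith
      _ = J * (5 * (x / L)) + 2000000 * (J * (x / L)) := by
        field_simp
        ring
      _ ≤ _ := by
        have : 0 ≤ J * (x / L) := by positivity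
        linarith
  have hsub : (((range J).biUnion E : Finset ℕ) : Set ℕ) ⊆ primeAddPowSet a b x := by
    intro n hn
    simp only [coe_biUnion, Set.mem_iUnion, mem_coe, E, mem_image, exists_prop] at hn
    obtain ⟨j, hj, p, hp, rfl⟩ := hn
    rw [hP, Nat.mem_primesLE] at hp
    refine ⟨by have := hp.2.pos; lia, ?_, p, j, hp.2, rfl⟩
    have h1 : ((p + a ^ j ^ b : ℕ) : ℝ) ≤ N + N := by
      exact_mod_cast Nat.add_le_add hp.1 (hpow j hj)
    linarith
  have hcard : (#((range J).biUnion E) : ℝ) ≤ (primeAddPowSet a b x).ncard := by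
    have := Set.ncard_le_ncard hsub (finite_primeAddPowSet a b x)
    rw [Set.ncard_coe_finset] at this
    exact_mod_cast this
  have hCS := sq_sum_card_le_card_biUnion_mul (range J) E
  rw [sum_congr rfl fun j _ => congrArg Nat.cast (hE j), sum_const, card_range,
    nsmul_eq_mul] at hCS
  have hxL : 0 < x / L := div_pos (by linarith) hL
  have hC0 : (0 : ℝ) ≤ (primeAddPowSet a b x).ncard := Nat.cast_nonneg _
  have hI : (0 : ℝ) ≤ ∑ i ∈ range J, ∑ j ∈ range J, (#(E i ∩ E j) : ℝ) :=
    sum_nonneg fun _ _ => sum_nonneg fun _ _ => Nat.cast_nonneg _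
  generalize ((primeAddPowSet a b x).ncard : ℝ) = C at hcard hC0 ⊢
  generalize (#((range J).biUnion E) : ℝ) = U at hcard hCS
  generalize ∑ i ∈ range J, ∑ j ∈ range J, (#(E i ∩ E j) : ℝ) = I at hsum hCS hI
  have hfin : ((J : ℝ) * #P) ^ 2 ≤ C * (3000000 * (J * (x / L))) :=
    hCS.trans ((mul_le_mul_of_nonneg_right hcard hI).trans
      (mul_le_mul_of_nonneg_left hsum hC0))
  have h1 : (J : ℝ) * (x / L) ≤ 40 * (J * #P) := by
    calc (J : ℝ) * (x / L) ≤ J * (40 * #P) := by gcongr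
      _ = _ := by ring
  -- 4800000000 = 40² · 3000000: the Chebyshev lower bound squared times the second moment constant.
  have h2 : (J : ℝ) * (x / L) ≤ 4800000000 * C := by
    have h3 : 0 < (J : ℝ) * (x / L) := by positivity
    refine le_of_mul_le_mul_right ?_ h3
    calc (J : ℝ) * (x / L) * (J * (x / L)) ≤ (40 * (J * #P)) * (40 * (J * #P)) := by gcongr
      _ = 1600 * ((J : ℝ) * #P) ^ 2 := by ring
      _ ≤ 1600 * (C * (3000000 * (J * (x / L)))) := by gcongr
      _ = _ := by ring
  calc R * (x / L) = a * (R / a * (x / L)) := by field_simp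
    _ ≤ a * (J * (x / L)) := by gcongr
    _ ≤ a * (4800000000 * C) := by gcongr
    _ = _ := by ring

theorem theorem9 (a b : ℕ) (ha : 2 ≤ a) (hb : 2 ≤ b) :
    ∃ c₁ c₂ : ℝ, 0 < c₁ ∧ 0 < c₂ ∧ ∀ x : ℝ, 3 ≤ x →
      c₁ * (x / (Real.log x) ^ (1 - 1 / (b : ℝ))) ≤
          (Set.ncard {n : ℕ | 1 ≤ n ∧ (n : ℝ) ≤ x ∧
            ∃ p j : ℕ, p.Prime ∧ p + a ^ (j ^ b) = n} : ℝ) ∧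
      (Set.ncard {n : ℕ | 1 ≤ n ∧ (n : ℝ) ≤ x ∧
            ∃ p j : ℕ, p.Prime ∧ p + a ^ (j ^ b) = n} : ℝ) ≤
          c₂ * (x / (Real.log x) ^ (1 - 1 / (b : ℝ))) := by
  have ha2 : (2 : ℝ) ≤ a := by exact_mod_cast ha
  refine ⟨1 / (4800000000 * a), 15, by positivity, by norm_num, fun x hx => ?_⟩
  have hL1 : 1 ≤ Real.log x := by
    rw [Real.le_log_iff_exp_le (by linarith)]
    have := Real.exp_one_lt_d9
    linarith
  have hR1 : 1 ≤ Real.log x ^ (1 / (b : ℝ)) := Real.one_le_rpow hL1 (by positivity)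
  have hR : (Real.log x ^ (1 / (b : ℝ))) ^ b = Real.log x := by
    rw [one_div]
    exact Real.rpow_inv_natCast_pow (by linarith) (by lia)
  rw [div_rpow_one_sub_one_div (by linarith)]
  refine ⟨?_, ncard_primeAddPowSet_le ha hb hx hR1 hR⟩
  rw [one_div_mul_eq_div, div_le_iff₀ (by positivity), mul_comm _ (4800000000 * (a : ℝ))]
  -- Below 16 the main term is at most x, since R ≤ L, and the element 3 = 2 + a^0 of the set
  -- suffices.
  by_cases hx16 : 16 ≤ x
  · exact le_ncard_primeAddPowSet ha hb hx16 hR1 hR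
  · have h1 : (1 : ℝ) ≤ (primeAddPowSet a b x).ncard := by
      exact_mod_cast one_le_ncard_primeAddPowSet a (by lia : b ≠ 0) hx
    have h2 : Real.log x ^ (1 / (b : ℝ)) ≤ Real.log x := by
      nth_rw 2 [← hR]
      exact le_self_pow₀ hR1 (by lia)
    calc Real.log x ^ (1 / (b : ℝ)) * (x / Real.log x)
        ≤ Real.log x * (x / Real.log x) := by
          gcongr
      _ = x := by field_simp
      _ ≤ 4800000000 * 2 * 1 := by linarith
      _ ≤ _ := by gcongr
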